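/- Write $\Lambda-x=\{y-x: y\in\Lambda\}$ and $\Lambda-\Lambda=\{y-x : x,y\in\Lambda\}$ for $\Lambda\subset\mathbb R^d$, and let $B_R$ be the closed ball of radius $R$ around $0$. A Delone set $\Lambda\subset\mathbb R^d$ is a uniformly discrete and relatively dense set; it is a Meyer set if moreover $\Lambda-\Lambda$ is uniformly discrete. It is repetitive if for every compact $B$ there is $R>0$ such that every closed ball of radius $R$ contains a translate $t+B$ of $B$ with $\Lambda\cap(t+B)=t+(\Lambda\cap B)$. The hull $\Omega_\Lambda$ is the closure of $\{\Lambda-t:t\in\mathbb R^d\}$, and $\Xi_\Lambda\subset\Omega_\Lambda$ is the closure of $\{\Lambda-x:x\in\Lambda\}$, in the topology in which two patterns are close if they are Hausdorff-close on a large ball around $0$. Let $\pi_{max}$ be the factor map of $(\Omega_\Lambda,\mathbb R^d)$ onto its maximal equicontinuous factor. Let $F:\Lambda\to\mathbb R^d$ be a generator of a shape deformation, i.e. its coboundary $\delta F(x,y)=F(y)-F(x)$ is strongly pattern equivariant: for every $r$ there is $R$ such that $F(y_1)-F(x_1)=F(y_2)-F(x_2)$ whenever $x_i,y_i\in\Lambda$,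 $y_1-x_1=y_2-x_2$ has norm at most $r$, and $(\Lambda-x_1)\cap B_R=(\Lambda-x_2)\cap B_R$. Assume also that $F$ is weakly pattern equivariant, i.e. there is a (necessarily unique) continuous $\tilde F:\Xi_\Lambda\to\mathbb R^d$ with $F(x)=\tilde F(\Lambda-x)$ for all $x\in\Lambda$. (These two conditions define the generators of shape semi-conjugacies; in particular every generator of a shape conjugacy is allowed.) $F$ is called nonslip if there is $\epsilon>0$ such that $\tilde F(\Lambda_1)=\tilde F(\Lambda_2)$ for all $\Lambda_1,\Lambda_2\in\Xi_\Lambda$ with $\pi_{max}(\Lambda_1)=\pi_{max}(\Lambda_2)$ and $\Lambda_1\cap B_{1/\epsilon}=\Lambda_2\cap B_{1/\epsilon}$. **Theorem.** Let $\Lambda\subset\mathbb R^d$ be a repetitive Meyer set and let $F:\Lambda\to\mathbb R^d$ be a weakly pattern equivariant generator of a shape deformation. If $F$ is not nonslip, then the deformed set $\Lambda^F=\{x+F(x):x\in\Lambda\}$ is not a Meyer set. -/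

import Mathlib

open Set Filter Topology Uniformity Metric
open scoped NNReal Pointwise

/-- A point pattern in the Euclidean space `ℝ^d`, that is, a subset of `ℝ^d`. -/
@[ext]
structure PointPattern (d : ℕ) where
  /-- The underlying set of points. -/
  carrier : Set (EuclideanSpace ℝ (Fin d))

namespace PointPattern

variable {d : ℕ}

/-! ### Geometry of point patterns -/

/-- A subset of `ℝ^d` is uniformly discrete if its distinct points have distances bounded below by
a positive constant. -/
def UniformlyDiscrete (S : Set (EuclideanSpace ℝ (Fin d))) : Prop :=
  ∃ r : ℝ≥0, 0 < r ∧ IsSeparated r S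

/-- A Delone set: the set of points of a term of Mathlib's `DeloneSet` (which bundles radii of
uniform discreteness and of relative denseness). -/
def IsDelone (Λ : PointPattern d) : Prop :=
  ∃ D : Delone.DeloneSet (EuclideanSpace ℝ (Fin d)), D.carrier = Λ.carrier

/-- A Meyer set: a Delone set whose set of difference vectors is uniformly discrete. -/
def IsMeyer (Λ : PointPattern d) : Prop :=
  Λ.IsDelone ∧ UniformlyDiscrete (Λ.carrier - Λ.carrier)

/-- `Λ` is repetitive: for every patch `(Λ ∩ B, B)` with `B` compact there is `R` such that every
ball of radius `R` contains a translate `t + B` on which `Λ` shows the translated patch. -/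
def IsRepetitive (Λ : PointPattern d) : Prop :=
  ∀ B : Set (EuclideanSpace ℝ (Fin d)), IsCompact B →
    ∃ R : ℝ, 0 < R ∧ ∀ x : EuclideanSpace ℝ (Fin d), ∃ t : EuclideanSpace ℝ (Fin d),
      t +ᵥ B ⊆ closedBall x R ∧ Λ.carrier ∩ (t +ᵥ B) = t +ᵥ (Λ.carrier ∩ B)

/-- Two patterns agree (exactly) out to radius `R` around the origin. -/
def AgreeTo (R : ℝ) (Λ₁ Λ₂ : PointPattern d) : Prop :=
  Λ₁.carrier ∩ closedBall 0 R = Λ₂.carrier ∩ closedBall 0 R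

/-! ### Translation action -/

/-- The translation action: `t +ᵥ Λ` is the translate `Λ + t`; in particular `-x +ᵥ Λ` is
`Λ - x`. -/
instance : AddAction (EuclideanSpace ℝ (Fin d)) (PointPattern d) where
  vadd t Λ := ⟨t +ᵥ Λ.carrier⟩
  zero_vadd Λ := PointPattern.ext (zero_vadd _ Λ.carrier)
  add_vadd s t Λ := PointPattern.ext (add_vadd s t Λ.carrier)

theorem carrier_vadd (t : EuclideanSpace ℝ (Fin d)) (Λ : PointPattern d) :
    (t +ᵥ Λ).carrier = t +ᵥ Λ.carrier := rfl

/-! ### The topology of local Hausdorff convergence -/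

/-- `Λ₁` and `Λ₂` are `ε`-close: each point of one of them in the ball of radius `ε⁻¹` around the
origin is within `ε` of a point of the other. -/
def Close (ε : ℝ) (Λ₁ Λ₂ : PointPattern d) : Prop :=
  (∀ x ∈ Λ₁.carrier, ‖x‖ ≤ ε⁻¹ → ∃ y ∈ Λ₂.carrier, dist x y ≤ ε) ∧
    (∀ y ∈ Λ₂.carrier, ‖y‖ ≤ ε⁻¹ → ∃ x ∈ Λ₁.carrier, dist y x ≤ ε)

theorem Close.symm {ε : ℝ} {Λ₁ Λ₂ : PointPattern d} (h : Close ε Λ₁ Λ₂) : Close ε Λ₂ Λ₁ :=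
  ⟨h.2, h.1⟩

theorem Close.refl {ε : ℝ} (hε : 0 < ε) (Λ : PointPattern d) : Close ε Λ Λ :=
  ⟨fun x hx _ => ⟨x, hx, by simpa using hε.le⟩, fun x hx _ => ⟨x, hx, by simpa using hε.le⟩⟩

theorem Close.mono {δ ε : ℝ} (hδ : 0 < δ) (h : δ ≤ ε) {Λ₁ Λ₂ : PointPattern d}
    (hc : Close δ Λ₁ Λ₂) : Close ε Λ₁ Λ₂ := by
  have hi : ε⁻¹ ≤ δ⁻¹ := inv_anti₀ hδ h
  refine ⟨fun x hx hxn => ?_, fun x hx hxn => ?_⟩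
  · obtain ⟨y, hy, hxy⟩ := hc.1 x hx (hxn.trans hi)
    exact ⟨y, hy, hxy.trans h⟩
  · obtain ⟨y, hy, hxy⟩ := hc.2 x hx (hxn.trans hi)
    exact ⟨y, hy, hxy.trans h⟩

theorem close_comp_aux {ε : ℝ} (hε : 0 < ε) :
    ε⁻¹ + min ε 1 / 2 ≤ (min ε 1 / 2)⁻¹ := by
  set δ := min ε 1 with hδ
  have h0 : 0 < δ := lt_min hε one_pos
  have h1 : ε⁻¹ ≤ δ⁻¹ := inv_anti₀ h0 (min_le_left _ _)
  have h2 : 1 ≤ δ⁻¹ := (one_le_inv₀ h0).2 (min_le_right _ _)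
  have h3 : δ ≤ 1 := min_le_right _ _
  have h4 : (δ / 2)⁻¹ = 2 * δ⁻¹ := by rw [inv_div]; rfl
  rw [h4]; linarith

theorem Close.trans_half {ε : ℝ} (hε : 0 < ε) {Λ₁ Λ₂ Λ₃ : PointPattern d}
    (h : Close (min ε 1 / 2) Λ₁ Λ₂) (h' : Close (min ε 1 / 2) Λ₂ Λ₃) : Close ε Λ₁ Λ₃ := by
  have key : ∀ {A B C : PointPattern d}, Close (min ε 1 / 2) A B → Close (min ε 1 / 2) B C →
      ∀ x ∈ A.carrier, ‖x‖ ≤ ε⁻¹ → ∃ y ∈ C.carrier, dist x y ≤ ε := by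
    intro A B C hAB hBC x hx hxn
    have haux := close_comp_aux hε
    have h0 : 0 < min ε 1 := lt_min hε one_pos
    obtain ⟨y, hy, hxy⟩ := hAB.1 x hx (by linarith)
    have hyn : ‖y‖ ≤ ‖x‖ + dist x y := by
      rw [dist_comm, dist_eq_norm]
      calc ‖y‖ = ‖x + (y - x)‖ := by congr 1; abel
        _ ≤ _ := norm_add_le _ _
    obtain ⟨z, hz, hyz⟩ := hBC.1 y hy (by linarith)
    refine ⟨z, hz, (dist_triangle x y z).trans ?_⟩
    have := min_le_left ε 1
    linarith
  exact ⟨key h h', key h'.symm h.symm⟩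

/-- The sets `{(Λ₁, Λ₂) | Close ε Λ₁ Λ₂}`, `ε > 0`, form a filter basis. -/
def closeBasis (d : ℕ) : FilterBasis (PointPattern d × PointPattern d) where
  sets := {U | ∃ ε : ℝ, 0 < ε ∧ U = {p | Close ε p.1 p.2}}
  nonempty := ⟨_, 1, one_pos, rfl⟩
  inter_sets := by
    rintro _ _ ⟨ε, hε, rfl⟩ ⟨ε', hε', rfl⟩
    refine ⟨_, ⟨min ε ε', lt_min hε hε', rfl⟩, fun p hp => ⟨?_, ?_⟩⟩
    · exact Close.mono (lt_min hε hε') (min_le_left _ _) hp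
    · exact Close.mono (lt_min hε hε') (min_le_right _ _) hp

/-- The uniform structure on patterns: two patterns are close if, on a large ball around the
origin, they are close in the Hausdorff sense. -/
instance : UniformSpace (PointPattern d) :=
  UniformSpace.ofCore <| UniformSpace.Core.mkOfBasis (closeBasis d)
    (by rintro _ ⟨ε, hε, rfl⟩ Λ; exact Close.refl hε Λ)
    (by rintro _ ⟨ε, hε, rfl⟩; exact ⟨_, ⟨ε, hε, rfl⟩, fun _ hp => Close.symm hp⟩)
    (by
      rintro _ ⟨ε, hε, rfl⟩
      refine ⟨_, ⟨min ε 1 / 2, half_pos (lt_min hε one_pos), rfl⟩, ?_⟩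
      rintro ⟨a, c⟩ ⟨b, hab, hbc⟩
      exact Close.trans_half hε hab hbc)

theorem hasBasis_uniformity :
    (𝓤 (PointPattern d)).HasBasis (fun ε : ℝ => 0 < ε) (fun ε => {p | Close ε p.1 p.2}) := by
  refine ⟨fun t => ?_⟩
  have h : t ∈ 𝓤 (PointPattern d) ↔ ∃ s ∈ (closeBasis d).sets, s ⊆ t := Iff.rfl
  rw [h]
  constructor
  · rintro ⟨_, ⟨ε, hε, rfl⟩, hs⟩
    exact ⟨ε, hε, hs⟩
  · rintro ⟨ε, hε, hs⟩
    exact ⟨_, ⟨ε, hε, rfl⟩, hs⟩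

theorem uniformContinuous_vadd (t : EuclideanSpace ℝ (Fin d)) :
    UniformContinuous (fun Λ : PointPattern d => t +ᵥ Λ) := by
  refine (hasBasis_uniformity.uniformContinuous_iff hasBasis_uniformity).2 fun ε hε => ?_
  have hpos : 0 < ε⁻¹ + ‖t‖ := by positivity
  refine ⟨min ε (ε⁻¹ + ‖t‖)⁻¹, lt_min hε (inv_pos.2 hpos), fun A B hAB => ?_⟩
  have hinv : ε⁻¹ + ‖t‖ ≤ (min ε (ε⁻¹ + ‖t‖)⁻¹)⁻¹ :=
    (le_inv_comm₀ hpos (lt_min hε (inv_pos.2 hpos))).2 (min_le_right _ _)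
  have key : ∀ {A B : PointPattern d}, Close (min ε (ε⁻¹ + ‖t‖)⁻¹) A B →
      ∀ x ∈ (t +ᵥ A).carrier, ‖x‖ ≤ ε⁻¹ → ∃ y ∈ (t +ᵥ B).carrier, dist x y ≤ ε := by
    rintro A B hAB _ ⟨x, hx, rfl⟩ hxn
    have hx' : ‖x‖ ≤ ε⁻¹ + ‖t‖ := by
      have : x = (t +ᵥ x) - t := by simp [vadd_eq_add]
      rw [this]
      exact (norm_sub_le _ _).trans (by gcongr)
    obtain ⟨y, hy, hxy⟩ := hAB.1 x hx (hx'.trans hinv)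
    refine ⟨t +ᵥ y, ⟨y, hy, rfl⟩, ?_⟩
    have : dist (t +ᵥ x) (t +ᵥ y) = dist x y := by simp
    exact this.le.trans (hxy.trans (min_le_left _ _))
  exact ⟨key hAB, key (Close.symm hAB)⟩

/-! ### Hull and canonical transversal -/

/-- The continuous hull `Ω_Λ`: the closure of the translation orbit of `Λ`. -/
def hull (Λ : PointPattern d) : Set (PointPattern d) :=
  closure (AddAction.orbit (EuclideanSpace ℝ (Fin d)) Λ)

theorem vadd_mem_hull {Λ Λ' : PointPattern d} (t : EuclideanSpace ℝ (Fin d))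
    (h : Λ' ∈ Λ.hull) : t +ᵥ Λ' ∈ Λ.hull := by
  refine map_mem_closure (uniformContinuous_vadd t).continuous h ?_
  rintro _ ⟨s, rfl⟩
  exact ⟨t + s, add_vadd t s Λ⟩

/-- The dynamical system `(Ω_Λ, ℝ^d)`: the translation action on the hull. -/
instance (Λ : PointPattern d) : AddAction (EuclideanSpace ℝ (Fin d)) Λ.hull where
  vadd t Λ' := ⟨t +ᵥ Λ'.1, vadd_mem_hull t Λ'.2⟩
  zero_vadd Λ' := Subtype.ext (zero_vadd _ Λ'.1)
  add_vadd s t Λ' := Subtype.ext (add_vadd s t Λ'.1)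

/-- The canonical transversal `Ξ_Λ`: the closure of `{Λ - x | x ∈ Λ}`. -/
def transversal (Λ : PointPattern d) : Set (PointPattern d) :=
  closure {Λ' | ∃ x ∈ Λ.carrier, Λ' = -x +ᵥ Λ}

end PointPattern

/-! ### The maximal equicontinuous factor -/

/-- The equivalence relation `R_max` of a topological dynamical system `(X, G)`: two points have the
same image in the maximal equicontinuous factor, the largest equicontinuous factor. Every
equicontinuous factor is a factor of the largest one, which is itself an equicontinuous factor;
hence this says that no equicontinuous factor `π : X → Y` on a compact Hausdorff space `Y`
separates the two points. -/
def RMax (G : Type) [AddGroup G] [TopologicalSpace G] {X : Type} [TopologicalSpace X]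
    [AddAction G X] (x₁ x₂ : X) : Prop :=
  ∀ (Y : Type) [UniformSpace Y] [CompactSpace Y] [T2Space Y] [AddAction G Y] [ContinuousVAdd G Y],
    UniformEquicontinuous (fun (g : G) (y : Y) => g +ᵥ y) →
    ∀ π : X → Y, Continuous π → Function.Surjective π →
      (∀ (g : G) (x : X), π (g +ᵥ x) = g +ᵥ π x) → π x₁ = π x₂

namespace PointPattern

variable {d : ℕ}

/-! ### Pattern equivariant functions and deformations -/

/-- The continuous function `Ftilde` on the canonical transversal represents `F : Λ → ℝ^d`, that is,
`F x = Ftilde (Λ - x)`. Such a function is determined by `F` on the transversal. -/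
def Represents (Λ : PointPattern d) (Ftilde : PointPattern d → EuclideanSpace ℝ (Fin d))
    (F : Λ.carrier → EuclideanSpace ℝ (Fin d)) : Prop :=
  ContinuousOn Ftilde Λ.transversal ∧ ∀ x : Λ.carrier, F x = Ftilde (-x.1 +ᵥ Λ)

/-- `F : Λ → ℝ^d` is weakly pattern equivariant. -/
def IsWeaklyPE (Λ : PointPattern d) (F : Λ.carrier → EuclideanSpace ℝ (Fin d)) : Prop :=
  ∃ Ftilde, Λ.Represents Ftilde F

/-- The coboundary `δF` is strongly pattern equivariant: for edges of bounded length, the value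
`δF(x, y) = F y - F x` depends only on the pattern of `Λ`, together with the edge, in a ball of some
fixed radius around the edge, up to translation. -/
def HasStronglyPECoboundary (Λ : PointPattern d) (F : Λ.carrier → EuclideanSpace ℝ (Fin d)) :
    Prop :=
  ∀ r : ℝ, ∃ R : ℝ, ∀ x₁ y₁ x₂ y₂ : Λ.carrier,
    dist x₁ y₁ ≤ r → (y₁ : EuclideanSpace ℝ (Fin d)) - x₁ = y₂ - x₂ →
    AgreeTo R (-x₁.1 +ᵥ Λ) (-x₂.1 +ᵥ Λ) → F y₁ - F x₁ = F y₂ - F x₂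

/-- `F` is the generator of a shape semi-conjugacy: a weakly pattern equivariant function whose
coboundary is strongly pattern equivariant. (A shape conjugacy is the special case in which the
induced map between the hulls is moreover injective.) -/
structure IsShapeSemiconjugacyGenerator (Λ : PointPattern d)
    (F : Λ.carrier → EuclideanSpace ℝ (Fin d)) : Prop where
  stronglyPE_coboundary : Λ.HasStronglyPECoboundary F
  weaklyPE : Λ.IsWeaklyPE F

/-- The deformed set `Λ^F = {x + F x | x ∈ Λ}`. -/
def deform (Λ : PointPattern d) (F : Λ.carrier → EuclideanSpace ℝ (Fin d)) : PointPattern d :=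
  ⟨range fun x : Λ.carrier => (x : EuclideanSpace ℝ (Fin d)) + F x⟩

/-- `F : Λ → ℝ^d` is nonslip: it is weakly pattern equivariant and there is `ε > 0` such that its
continuous extension `Ftilde` to the transversal takes the same value at any two elements of the
transversal that have the same image in the maximal equicontinuous factor of `(Ω_Λ, ℝ^d)` and agree
out to radius `ε⁻¹`. -/
def IsNonslip (Λ : PointPattern d) (F : Λ.carrier → EuclideanSpace ℝ (Fin d)) : Prop :=
  ∃ Ftilde, Λ.Represents Ftilde F ∧ ∃ ε : ℝ, 0 < ε ∧
    ∀ Λ₁ Λ₂ : Λ.hull, Λ₁.1 ∈ Λ.transversal → Λ₂.1 ∈ Λ.transversal →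
      RMax (EuclideanSpace ℝ (Fin d)) Λ₁ Λ₂ → AgreeTo ε⁻¹ Λ₁.1 Λ₂.1 →
        Ftilde Λ₁.1 = Ftilde Λ₂.1

end PointPattern

/-! The contrapositive is proved: if the differences of `Λ.deform F` are uniformly discrete, then
`F` is nonslip. Let `Λ₁`, `Λ₂` in the transversal have the same image in the maximal equicontinuous
factor.

Repetitivity makes the hull minimal, so `RMax.regionallyProximal` gives patterns near `Λ₁` and `Λ₂`
which one common translation brings near `Λ₁`. Approximating by translates of `Λ` and recentring at
points of `Λ` produces two almost equal return vectors. Since `Λ - Λ` is uniformly discrete they are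
equal: `y₁ - x₁ = y₂ - x₂` (`exists_common_return_vector`).

After deformation these vectors differ by `(F y₁ - F y₂) - (F x₁ - F x₂)`. The first bracket is
arbitrarily small, because `y₁` and `y₂` both look like `Λ₁`. The second is nearly `Ftilde Λ₁ -
Ftilde Λ₂`, which is small once `Λ₁` and `Λ₂` agree on a large ball. Uniform discreteness makes the
total zero, so the second bracket is arbitrarily small too, and `Ftilde Λ₁ = Ftilde Λ₂`.

Regional proximality uses an invariant measure `μ`: the fibres of a closed invariant relation, taken
modulo `μ`-null sets, form an equicontinuous factor. -/

/-! ### Invariant measures of abelian group actions -/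

section InvariantMeasure

open MeasureTheory
open scoped BoundedContinuousFunction

variable {X : Type*} [TopologicalSpace X] [MeasurableSpace X] [BorelSpace X]

/-- The average of the first `n + 1` push-forwards of `μ` under the iterates of `T`. -/
noncomputable def birkhoffMeasure (T : X → X) (μ : Measure X) (n : ℕ) : Measure X :=
  ((n + 1 : ℕ) : ENNReal)⁻¹ • ∑ i ∈ Finset.range (n + 1), μ.map (T^[i])

theorem isProbabilityMeasure_birkhoffMeasure {T : X → X} (hT : Continuous T) (μ : Measure X)
    [IsProbabilityMeasure μ] (n : ℕ) : IsProbabilityMeasure (birkhoffMeasure T μ n) := by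
  constructor
  have h : ∀ i, μ.map (T^[i]) univ = 1 := fun i => by
    rw [Measure.map_apply (hT.iterate i).measurable MeasurableSet.univ]; simp
  simp only [birkhoffMeasure, Measure.smul_apply, Measure.finsetSum_apply, h, smul_eq_mul,
    Finset.sum_const, Finset.card_range, nsmul_eq_mul, mul_one]
  exact ENNReal.inv_mul_cancel (by simp) (ENNReal.natCast_ne_top _)

theorem integral_birkhoffMeasure {T : X → X} (hT : Continuous T) (μ : Measure X)
    [IsProbabilityMeasure μ] (n : ℕ) (f : X →ᵇ ℝ) :
    ∫ x, f x ∂(birkhoffMeasure T μ n) =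
      ((n + 1 : ℕ) : ℝ)⁻¹ * ∑ i ∈ Finset.range (n + 1), ∫ x, f (T^[i] x) ∂μ := by
  have hp : ∀ i, IsProbabilityMeasure (μ.map (T^[i])) := fun i =>
    Measure.isProbabilityMeasure_map (hT.iterate i).aemeasurable
  rw [birkhoffMeasure, integral_smul_measure, integral_finsetSum_measure]
  · simp only [ENNReal.toReal_inv, ENNReal.toReal_natCast, smul_eq_mul]
    congr 1
    refine Finset.sum_congr rfl fun i _ => ?_
    exact integral_map (hT.iterate i).aemeasurable f.continuous.measurable.aestronglyMeasurable
  · intro i _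
    exact f.integrable _

/-- Averaging along one map keeps the invariance already gained under maps commuting with it, so
invariance can be acquired one group element at a time. -/
theorem map_birkhoffMeasure_of_commute {T S : X → X} (hT : Continuous T) (hS : Continuous S)
    (hTS : Function.Commute T S) {μ : Measure X} (hμ : μ.map S = μ) (n : ℕ) :
    (birkhoffMeasure T μ n).map S = birkhoffMeasure T μ n := by
  rw [birkhoffMeasure, Measure.map_smul]
  congr 1
  rw [← Measure.mapₗ_apply_of_measurable hS.measurable, map_sum]
  refine Finset.sum_congr rfl fun i _ => ?_
  rw [Measure.mapₗ_apply_of_measurable hS.measurable,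
    Measure.map_map hS.measurable (hT.iterate i).measurable,
    ← (hTS.iterate_left i).comp_eq, ← Measure.map_map (hT.iterate i).measurable hS.measurable, hμ]

variable [TopologicalSpace.PseudoMetrizableSpace X]

theorem isClosed_setOf_map_eq {T : X → X} (hT : Continuous T) :
    IsClosed {μ : ProbabilityMeasure X | μ.map hT.aemeasurable = μ} :=
  isClosed_eq (ProbabilityMeasure.continuous_map hT) continuous_id

variable [CompactSpace X] [T2Space X]

/-- A limit of the averages of `μ` along the iterates of `T` is `T`-invariant. -/
theorem exists_map_eq_of_isClosed {T : X → X} (hT : Continuous T)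
    {K : Set (ProbabilityMeasure X)} (hK : IsClosed K) (ν : ℕ → ProbabilityMeasure X)
    (hνK : ∀ n, ν n ∈ K) {μ : Measure X} [IsProbabilityMeasure μ]
    (hν : ∀ n, (ν n : Measure X) = birkhoffMeasure T μ n) :
    ∃ m ∈ K, m.map hT.aemeasurable = m := by
  obtain ⟨m, -, hm⟩ := isCompact_univ.ultrafilter_le_nhds' ((hyperfilter ℕ).map ν) univ_mem
  have hm' : Tendsto ν (hyperfilter ℕ) (𝓝 m) := hm
  refine ⟨m, hK.mem_of_tendsto hm' (Eventually.of_forall hνK), ?_⟩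
  -- The two averages telescope: only the first and the last term survive.
  have hbound : ∀ f : X →ᵇ ℝ, ∀ n : ℕ,
      |∫ x, f (T x) ∂(ν n : Measure X) - ∫ x, f x ∂(ν n : Measure X)| ≤
        ((n + 1 : ℕ) : ℝ)⁻¹ * (2 * ‖f‖) := by
    intro f n
    have e1 : ∫ x, f (T x) ∂(ν n : Measure X) =
        ((n + 1 : ℕ) : ℝ)⁻¹ * ∑ i ∈ Finset.range (n + 1), ∫ x, f (T^[i + 1] x) ∂μ := by
      rw [hν]
      simp only [Function.iterate_succ_apply']
      exact integral_birkhoffMeasure hT μ n (f.compContinuous ⟨T, hT⟩)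
    rw [e1, hν, integral_birkhoffMeasure hT μ n f, ← mul_sub, ← Finset.sum_sub_distrib,
      Finset.sum_range_sub (fun i => ∫ x, f (T^[i] x) ∂μ), abs_mul,
      abs_of_nonneg (by positivity : (0 : ℝ) ≤ ((n + 1 : ℕ) : ℝ)⁻¹)]
    gcongr
    have h : ∀ i, |∫ x, f (T^[i] x) ∂μ| ≤ ‖f‖ := fun i => by
      have := norm_integral_le_of_norm_le_const (μ := μ) (f := fun x => f (T^[i] x)) (C := ‖f‖)
        (Eventually.of_forall fun x => f.norm_coe_le_norm _)
      simpa using this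
    calc _ ≤ _ := abs_sub _ _
      _ ≤ ‖f‖ + ‖f‖ := add_le_add (h _) (h _)
      _ = 2 * ‖f‖ := by ring
  have hint : ∀ f : X →ᵇ ℝ,
      Tendsto (fun n => ∫ x, f x ∂(ν n : Measure X)) (hyperfilter ℕ) (𝓝 (∫ x, f x ∂(m : Measure X))) :=
    ProbabilityMeasure.tendsto_iff_forall_integral_tendsto.1 hm'
  have hP : ∀ ρ : ProbabilityMeasure X, IsProbabilityMeasure ρ.1 := fun ρ => ρ.2
  refine Subtype.ext (ext_of_forall_integral_eq_of_IsFiniteMeasure fun f => ?_)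
  have e2 : ∫ x, f x ∂((m.map hT.aemeasurable : ProbabilityMeasure X) : Measure X) =
      ∫ x, f (T x) ∂(m : Measure X) := by
    rw [ProbabilityMeasure.toMeasure_map]
    exact integral_map hT.aemeasurable f.continuous.measurable.aestronglyMeasurable
  change ∫ x, f x ∂((m.map hT.aemeasurable : ProbabilityMeasure X) : Measure X) =
      ∫ x, f x ∂(m : Measure X)
  rw [e2, ← sub_eq_zero]
  refine tendsto_nhds_unique ((hint (f.compContinuous ⟨T, hT⟩)).sub (hint f)) ?_
  refine squeeze_zero_norm (hbound f) (Tendsto.mono_left ?_ Nat.hyperfilter_le_atTop)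
  have h0 : Tendsto (fun n : ℕ => ((n + 1 : ℕ) : ℝ)⁻¹) atTop (𝓝 0) :=
    tendsto_inv_atTop_zero.comp (tendsto_natCast_atTop_atTop.comp (tendsto_add_atTop_nat 1))
  simpa using h0.mul_const (2 * ‖f‖)

/-- An action of an abelian group by continuous maps on a nonempty compact metrizable space has an
invariant Borel probability measure. -/
theorem exists_vaddInvariant_probabilityMeasure (G : Type*) [AddCommGroup G] [AddAction G X]
    [ContinuousConstVAdd G X] [Nonempty X] :
    ∃ μ : ProbabilityMeasure X, ∀ g : G, (μ : Measure X).map (g +ᵥ ·) = μ := by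
  classical
  let C : G → Set (ProbabilityMeasure X) := fun g =>
    {μ | μ.map (continuous_const_vadd g).aemeasurable = μ}
  have hC : ∀ g, IsClosed (C g) := fun g => isClosed_setOf_map_eq (continuous_const_vadd g)
  -- By compactness, finitely many group elements at a time suffice.
  have hfin : ∀ s : Finset G, (⋂ g ∈ s, C g).Nonempty := by
    intro s
    induction s using Finset.induction_on with
    | empty =>
      obtain ⟨x⟩ := ‹Nonempty X›
      exact ⟨⟨Measure.dirac x, inferInstance⟩, mem_iInter₂.2 fun g hg => absurd hg (Finset.notMem_empty g)⟩
    | insert h s _ ih =>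
      obtain ⟨μ, hμ⟩ := ih
      have hh := continuous_const_vadd (T := X) h
      let ν : ℕ → ProbabilityMeasure X := fun n =>
        ⟨birkhoffMeasure (h +ᵥ ·) (μ : Measure X) n, isProbabilityMeasure_birkhoffMeasure hh _ n⟩
      obtain ⟨m, hmK, hm⟩ := exists_map_eq_of_isClosed hh (K := ⋂ g ∈ s, C g)
        (isClosed_biInter fun g _ => hC g) ν (fun n => by
          refine mem_iInter₂.2 fun g hg => Subtype.ext ?_
          refine map_birkhoffMeasure_of_commute hh (continuous_const_vadd g)
            (fun x => vadd_comm h g x) ?_ n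
          exact congrArg Subtype.val (mem_iInter₂.1 hμ g hg)) (fun n => rfl)
      exact ⟨m, by simpa [Finset.set_biInter_insert] using ⟨hm, by simpa using hmK⟩⟩
  obtain ⟨μ, -, hμ⟩ := isCompact_univ.inter_iInter_nonempty C hC
    (fun s => by simpa using hfin s)
  exact ⟨μ, fun g => congrArg Subtype.val (mem_iInter.1 hμ g)⟩

end InvariantMeasure

/-! ### Regional proximality -/

/-- A continuous map to an extended metric space on whose image the group acts by isometries
identifies points with the same image in the maximal equicontinuous factor. -/
theorem RMax.eq_of_edist_vadd {G : Type} [AddGroup G] [TopologicalSpace G] {X : Type}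
    [TopologicalSpace X] [CompactSpace X] [AddAction G X]
    (hcont : ∀ x : X, Continuous fun g : G => g +ᵥ x)
    {E : Type} [EMetricSpace E] {Φ : X → E} (hΦ : Continuous Φ)
    (hiso : ∀ (g : G) (x y : X), edist (Φ (g +ᵥ x)) (Φ (g +ᵥ y)) = edist (Φ x) (Φ y))
    {x₁ x₂ : X} (h : RMax G x₁ x₂) : Φ x₁ = Φ x₂ := by
  -- The image of `Φ` is the equicontinuous factor on which `RMax` is tested. The action descends to
  -- it because points at distance zero stay at distance zero.
  let π : X → range Φ := rangeFactorization Φ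
  have hπ : Continuous π := hΦ.subtype_mk _
  have hπs : Function.Surjective π := rangeFactorization_surjective
  have hwd : ∀ (g : G) (x y : X), π x = π y → π (g +ᵥ x) = π (g +ᵥ y) := by
    intro g x y hxy
    refine Subtype.ext (edist_eq_zero.1 ?_)
    rw [show ((π (g +ᵥ x) : range Φ) : E) = Φ (g +ᵥ x) from rfl,
      show ((π (g +ᵥ y) : range Φ) : E) = Φ (g +ᵥ y) from rfl, hiso]
    exact edist_eq_zero.2 (congrArg Subtype.val hxy)
  let act : G → range Φ → range Φ := fun g y => π (g +ᵥ Function.surjInv hπs y)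
  have hact : ∀ g x, act g (π x) = π (g +ᵥ x) := fun g x =>
    hwd g _ _ (Function.surjInv_eq hπs (π x))
  let : AddAction G (range Φ) :=
    { vadd := act
      zero_vadd := fun y => by
        obtain ⟨x, rfl⟩ := hπs y
        exact (hact 0 x).trans (by rw [zero_vadd])
      add_vadd := fun g g' y => by
        obtain ⟨x, rfl⟩ := hπs y
        refine (hact (g + g') x).trans (Eq.symm ?_)
        rw [add_vadd]
        exact (congrArg (act g) (hact g' x)).trans (hact g (g' +ᵥ x)) }
  have hvadd : ∀ (g : G) (x : X), g +ᵥ π x = π (g +ᵥ x) := hact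
  have hedist : ∀ (g : G) (y z : range Φ), edist (g +ᵥ y) (g +ᵥ z) = edist y z := by
    intro g y z
    obtain ⟨x, rfl⟩ := hπs y
    obtain ⟨x', rfl⟩ := hπs z
    rw [hvadd, hvadd]
    exact hiso g x x'
  have : CompactSpace (range Φ) := isCompact_iff_compactSpace.1 (isCompact_range hΦ)
  have : ContinuousVAdd G (range Φ) := by
    refine ⟨continuous_iff_continuousAt.2 fun ⟨g, y⟩ => ?_⟩
    obtain ⟨x, rfl⟩ := hπs y
    refine tendsto_iff_edist_tendsto_0.2 ?_
    -- Joint continuity: isometry controls the change of the point, continuity of a single orbit map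
    -- the change of the group element.
    have h1 : Tendsto (fun p : G × range Φ => edist p.2 (π x) + edist (π (p.1 +ᵥ x)) (π (g +ᵥ x)))
        (𝓝 (g, π x)) (𝓝 0) := by
      have : Continuous fun p : G × range Φ =>
          edist p.2 (π x) + edist (π (p.1 +ᵥ x)) (π (g +ᵥ x)) :=
        (continuous_snd.edist continuous_const).add
          ((hπ.comp ((hcont x).comp continuous_fst)).edist continuous_const)
      simpa using this.tendsto (g, π x)
    refine tendsto_of_tendsto_of_tendsto_of_le_of_le tendsto_const_nhds h1
      (fun _ => zero_le) fun p => ?_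
    calc edist (p.1 +ᵥ p.2) (g +ᵥ π x)
        ≤ edist (p.1 +ᵥ p.2) (p.1 +ᵥ π x) + edist (p.1 +ᵥ π x) (g +ᵥ π x) := edist_triangle _ _ _
      _ = _ := by rw [hedist, hvadd, hvadd]
  have hequi : UniformEquicontinuous (fun (g : G) (y : range Φ) => g +ᵥ y) := by
    intro U hU
    obtain ⟨ε, hε, hU⟩ := uniformity_basis_edist.mem_iff.1 hU
    filter_upwards [uniformity_basis_edist.mem_of_mem hε] with p hp g
    exact hU (show edist (g +ᵥ p.1) (g +ᵥ p.2) < ε by rwa [hedist])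
  exact congrArg Subtype.val (h (range Φ) hequi π hπ hπs fun g x => (hvadd g x).symm)

/-! ### Fibres of closed invariant relations -/

section RegionalProximality

open MeasureTheory
open scoped symmDiff ENNReal

/-- Near `x`, the fibres of a closed set over a compact space lie in a given open neighbourhood of
the fibre over `x`. -/
theorem IsClosed.eventually_fiber_subset {X Y : Type*} [TopologicalSpace X] [TopologicalSpace Y]
    [CompactSpace Y] {N : Set (X × Y)} (hN : IsClosed N) {x : X} {U : Set Y} (hU : IsOpen U)
    (hxU : Prod.mk x ⁻¹' N ⊆ U) : ∀ᶠ y in 𝓝 x, Prod.mk y ⁻¹' N ⊆ U := by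
  have hcl : IsClosed (Prod.fst '' (N ∩ Prod.snd ⁻¹' Uᶜ)) :=
    isClosedMap_fst_of_compactSpace _ (hN.inter (hU.isClosed_compl.preimage continuous_snd))
  have hx : x ∈ (Prod.fst '' (N ∩ Prod.snd ⁻¹' Uᶜ))ᶜ := by
    rintro ⟨⟨a, b⟩, ⟨hab, hb⟩, rfl⟩
    exact hb (hxU hab)
  filter_upwards [hcl.isOpen_compl.mem_nhds hx] with y hy z hz
  by_contra hzU
  exact hy ⟨(y, z), ⟨hz, hzU⟩, rfl⟩

variable {G X : Type*} [AddGroup G] [AddAction G X]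

theorem preimage_mk_vadd {N : Set (X × X)} (hN : ∀ (g : G) (p : X × X), p ∈ N → g +ᵥ p ∈ N)
    (g : G) (x : X) : Prod.mk (g +ᵥ x) ⁻¹' N = (-g +ᵥ ·) ⁻¹' (Prod.mk x ⁻¹' N) := by
  ext z
  refine ⟨fun h => ?_, fun h => ?_⟩
  · simpa [Prod.vadd_mk] using hN (-g) _ h
  · simpa [Prod.vadd_mk] using hN g _ h

variable [TopologicalSpace X] [CompactSpace X] [T2Space X]
  [TopologicalSpace.PseudoMetrizableSpace X] [MeasurableSpace X] [BorelSpace X]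

/-- In a minimal system, the fibres of a closed invariant relation have the same measure. -/
theorem measure_fiber_eq [AddAction.IsMinimal G X] {N : Set (X × X)} (hNc : IsClosed N)
    (hN : ∀ (g : G) (p : X × X), p ∈ N → g +ᵥ p ∈ N) {μ : Measure X} [IsFiniteMeasure μ]
    (hμ : ∀ g : G, MeasurePreserving (g +ᵥ ·) μ μ) (x y : X) :
    μ (Prod.mk x ⁻¹' N) = μ (Prod.mk y ⁻¹' N) := by
  have hmeas : ∀ x : X, MeasurableSet (Prod.mk x ⁻¹' N) := fun x =>
    (hNc.preimage (Continuous.prodMk_right x)).measurableSet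
  suffices h : ∀ x y : X, μ (Prod.mk x ⁻¹' N) ≤ μ (Prod.mk y ⁻¹' N) from le_antisymm (h x y) (h y x)
  intro x y
  refine le_of_forall_gt fun c hc => ?_
  -- Fibres vary upper semicontinuously, so `U` contains the fibre over some point of the orbit of
  -- `x`, which has the same measure as the fibre over `x`.
  obtain ⟨U, hyU, hU, hUc⟩ := (Prod.mk y ⁻¹' N).exists_isOpen_lt_of_lt c hc
  have hev := hNc.eventually_fiber_subset hU hyU
  obtain ⟨_, ⟨g, rfl⟩, hz⟩ := (AddAction.dense_orbit G x).inter_nhds_nonempty hev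
  calc μ (Prod.mk x ⁻¹' N) = μ ((-g +ᵥ ·) ⁻¹' (Prod.mk x ⁻¹' N)) :=
        ((hμ (-g)).measure_preimage (hmeas x).nullMeasurableSet).symm
    _ = μ (Prod.mk (g +ᵥ x) ⁻¹' N) := by rw [preimage_mk_vadd hN]
    _ ≤ μ U := measure_mono hz
    _ < c := hUc

/-- In a minimal system, the fibres of a closed invariant relation depend continuously on the base
point, with respect to the measure of symmetric differences. -/
theorem continuous_fiber [AddAction.IsMinimal G X] {N : Set (X × X)} (hNc : IsClosed N)
    (hN : ∀ (g : G) (p : X × X), p ∈ N → g +ᵥ p ∈ N) {μ : Measure X} [IsFiniteMeasure μ]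
    (hμ : ∀ g : G, MeasurePreserving (g +ᵥ ·) μ μ)
    (hmeas : ∀ x : X, MeasurableSet (Prod.mk x ⁻¹' N)) :
    Continuous (Y := MeasuredSets μ) (fun x : X => ⟨Prod.mk x ⁻¹' N, hmeas x⟩) := by
  refine continuous_iff_continuousAt.2 fun x => EMetric.tendsto_nhds.2 fun ε hε => ?_
  have hε2 : ε / 2 ≠ 0 := (ENNReal.half_pos hε.ne').ne'
  obtain ⟨U, hxU, hU, hUε⟩ := (Prod.mk x ⁻¹' N).exists_isOpen_lt_add (measure_ne_top μ _) hε2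
  filter_upwards [hNc.eventually_fiber_subset hU hxU] with y hy
  have heq := measure_fiber_eq hNc hN hμ x y
  have h1 : μ (Prod.mk y ⁻¹' N \ Prod.mk x ⁻¹' N) < ε / 2 := by
    refine (measure_mono (sdiff_subset_sdiff_left hy)).trans_lt ?_
    rw [measure_sdiff hxU (hmeas x).nullMeasurableSet (measure_ne_top μ _)]
    exact ENNReal.sub_lt_of_lt_add (measure_mono hxU) (by rwa [add_comm])
  -- Semicontinuity bounds only one difference; equality of the fibre measures transfers the bound
  -- to the other.
  have h2 : μ (Prod.mk x ⁻¹' N \ Prod.mk y ⁻¹' N) = μ (Prod.mk y ⁻¹' N \ Prod.mk x ⁻¹' N) := by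
    have a := measure_sdiff_add_inter (μ := μ) (Prod.mk x ⁻¹' N) (hmeas y)
    have b := measure_sdiff_add_inter (μ := μ) (Prod.mk y ⁻¹' N) (hmeas x)
    rw [inter_comm] at b
    exact (ENNReal.add_left_inj (measure_ne_top μ _)).1 ((a.trans heq).trans b.symm)
  calc μ ((Prod.mk y ⁻¹' N) ∆ (Prod.mk x ⁻¹' N))
      ≤ μ (Prod.mk y ⁻¹' N \ Prod.mk x ⁻¹' N) + μ (Prod.mk x ⁻¹' N \ Prod.mk y ⁻¹' N) :=
        measure_union_le _ _
    _ < ε / 2 + ε / 2 := by rw [h2]; exact ENNReal.add_lt_add h1 h1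
    _ = ε := ENNReal.add_halves ε

end RegionalProximality

/-- Two points of a minimal system of an abelian group with the same image in the maximal
equicontinuous factor are regionally proximal. -/
theorem RMax.regionallyProximal {G : Type} [AddCommGroup G] [TopologicalSpace G] {X : Type}
    [TopologicalSpace X] [CompactSpace X] [T2Space X] [TopologicalSpace.PseudoMetrizableSpace X]
    [AddAction G X] [ContinuousConstVAdd G X] [AddAction.IsMinimal G X]
    (hcont : ∀ x : X, Continuous fun g : G => g +ᵥ x) {x₁ x₂ : X} (h : RMax G x₁ x₂)
    {V W : Set X} (hV : IsOpen V) (hx₁ : x₁ ∈ V) (hW : IsOpen W) (hx₂ : x₂ ∈ W) :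
    ∃ z ∈ W, ∃ z' ∈ V, ∃ t : G, t +ᵥ z ∈ V ∧ t +ᵥ z' ∈ V := by
  let : MeasurableSpace X := borel X
  have : BorelSpace X := ⟨rfl⟩
  have : Nonempty X := ⟨x₁⟩
  obtain ⟨⟨μ, hμ1⟩, hμ⟩ := exists_vaddInvariant_probabilityMeasure (X := X) G
  have hmp : ∀ g : G, MeasureTheory.MeasurePreserving (g +ᵥ ·) μ μ := fun g =>
    ⟨(continuous_const_vadd g).measurable, hμ g⟩
  have : MeasureTheory.VAddInvariantMeasure G X μ :=
    ⟨fun g s hs => (hmp g).measure_preimage hs.nullMeasurableSet⟩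
  -- The goal reduces to `(x₂, x₁) ∈ closure O`.
  let O : Set (X × X) := {p | ∃ t : G, t +ᵥ p.1 ∈ V ∧ t +ᵥ p.2 ∈ V}
  let N : Set (X × X) := closure O
  have hN : ∀ (g : G) (p : X × X), p ∈ N → g +ᵥ p ∈ N := by
    intro g p hp
    refine map_mem_closure (continuous_const_vadd g) hp ?_
    rintro ⟨a, b⟩ ⟨t, ha, hb⟩
    exact ⟨t - g, by simpa [vadd_vadd] using ha, by simpa [vadd_vadd] using hb⟩
  have hNc : IsClosed N := isClosed_closure
  have hmeas : ∀ x : X, MeasurableSet (Prod.mk x ⁻¹' N) := fun x =>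
    (hNc.preimage (Continuous.prodMk_right x)).measurableSet
  have hcf := continuous_fiber hNc hN hmp hmeas
  -- Sets differing by a null set are at distance zero, hence the separation quotient.
  have key := h.eq_of_edist_vadd hcont (SeparationQuotient.continuous_mk.comp hcf) (by
    intro g x y
    change μ (symmDiff (Prod.mk (g +ᵥ x) ⁻¹' N) (Prod.mk (g +ᵥ y) ⁻¹' N)) =
      μ (symmDiff (Prod.mk x ⁻¹' N) (Prod.mk y ⁻¹' N))
    rw [preimage_mk_vadd hN, preimage_mk_vadd hN, ← preimage_symmDiff]
    exact (hmp (-g)).measure_preimage ((hmeas x).symmDiff (hmeas y)).nullMeasurableSet)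
  have hzero : μ (symmDiff (Prod.mk x₁ ⁻¹' N) (Prod.mk x₂ ⁻¹' N)) = 0 := by
    exact edist_eq_zero.2 key
  have hVN : V ⊆ Prod.mk x₁ ⁻¹' N := fun z hz =>
    subset_closure ⟨0, by simpa using hx₁, by simpa using hz⟩
  -- This set is open and null, and by minimality an invariant probability measure charges every
  -- nonempty open set.
  have hpos : V \ Prod.mk x₂ ⁻¹' N = ∅ := by
    by_contra hne
    have hopen : IsOpen (V \ Prod.mk x₂ ⁻¹' N) :=
      hV.sdiff (hNc.preimage (Continuous.prodMk_right x₂))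
    have := MeasureTheory.measure_isOpen_pos_of_vaddInvariant_of_ne_zero (μ := μ) G
      (MeasureTheory.IsProbabilityMeasure.ne_zero μ) hopen (nonempty_iff_ne_empty.2 hne)
    refine this.ne' (MeasureTheory.measure_mono_null ?_ hzero)
    exact fun z hz => Or.inl ⟨hVN hz.1, hz.2⟩
  have hmem : (x₂, x₁) ∈ N := by
    by_contra hn
    exact hpos.le (show x₁ ∈ V \ Prod.mk x₂ ⁻¹' N from ⟨hx₁, hn⟩)
  obtain ⟨⟨z, z'⟩, ⟨hz, hz'⟩, t, ht, ht'⟩ :=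
    mem_closure_iff.1 hmem (W ×ˢ V) (hW.prod hV) ⟨hx₂, hx₁⟩
  exact ⟨z, hz, z', hz', t, ht, ht'⟩

namespace PointPattern

variable {d : ℕ}

/-! ### The hull as a topological dynamical system -/

theorem nhds_hasBasis_close (Λ : PointPattern d) :
    (𝓝 Λ).HasBasis (fun ε : ℝ => 0 < ε) (fun ε => {Λ' | Close ε Λ Λ'}) :=
  nhds_basis_uniformity' hasBasis_uniformity

theorem mem_closure_iff_close {S : Set (PointPattern d)} {Λ : PointPattern d} :
    Λ ∈ closure S ↔ ∀ ε : ℝ, 0 < ε → ∃ Λ' ∈ S, Close ε Λ Λ' := by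
  simpa [Set.Nonempty, and_comm] using mem_closure_iff_nhds_basis' (nhds_hasBasis_close Λ) (t := S)

theorem mem_vadd_iff {t p : EuclideanSpace ℝ (Fin d)} {Λ : PointPattern d} :
    p ∈ (t +ᵥ Λ).carrier ↔ p - t ∈ Λ.carrier := by
  rw [carrier_vadd, mem_vadd_set_iff_neg_vadd_mem, vadd_eq_add, neg_add_eq_sub]

theorem close_vadd_self {ε : ℝ} {t : EuclideanSpace ℝ (Fin d)} (ht : ‖t‖ ≤ ε)
    (Λ : PointPattern d) : Close ε Λ (t +ᵥ Λ) := by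
  refine ⟨fun x hx _ => ⟨x + t, mem_vadd_iff.2 (by simpa using hx), ?_⟩,
    fun y hy _ => ⟨y - t, mem_vadd_iff.1 hy, ?_⟩⟩
  · simpa [dist_eq_norm] using ht
  · simpa [dist_eq_norm] using ht

/-- The space of patterns is compact. -/
instance : CompactSpace (PointPattern d) := by
  refine ⟨isCompact_iff_ultrafilter_le_nhds.2 fun U _ => ?_⟩
  -- The ultrafilter limit consists of the points approximated by almost every pattern.
  let L : PointPattern d := ⟨{p | ∀ ε : ℝ, 0 < ε → ∀ᶠ Λ in (U : Filter (PointPattern d)),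
    ∃ q ∈ Λ.carrier, dist p q ≤ ε}⟩
  refine ⟨L, mem_univ _, (nhds_hasBasis_close L).ge_iff.2 fun ε hε => ?_⟩
  have h1 : ∀ᶠ Λ in (U : Filter (PointPattern d)),
      ∀ p ∈ L.carrier, ‖p‖ ≤ ε⁻¹ → ∃ q ∈ Λ.carrier, dist p q ≤ ε := by
    have htb : TotallyBounded (L.carrier ∩ closedBall 0 ε⁻¹) :=
      (isCompact_closedBall (0 : EuclideanSpace ℝ (Fin d)) ε⁻¹).totallyBounded.subset
        inter_subset_right
    obtain ⟨T, hTL, hT, hcov⟩ := finite_approx_of_totallyBounded htb (ε / 2) (half_pos hε)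
    have hev : ∀ᶠ Λ in (U : Filter (PointPattern d)), ∀ p ∈ T, ∃ q ∈ Λ.carrier, dist p q ≤ ε / 2 :=
      (eventually_all_finite hT).2 fun p hp => (hTL hp).1 _ (half_pos hε)
    filter_upwards [hev] with Λ hΛ p hp hpn
    obtain ⟨p', hp', hpp'⟩ := mem_iUnion₂.1 (hcov ⟨hp, mem_closedBall_zero_iff.2 hpn⟩)
    obtain ⟨q, hq, hq'⟩ := hΛ p' hp'
    refine ⟨q, hq, (dist_triangle p p' q).trans ?_⟩
    have := (mem_ball.1 hpp').le
    linarith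
  -- Otherwise points far from `L` could be chosen in almost every pattern within a fixed ball;
  -- their limit along `U` would lie in `L`.
  have h2 : ∀ᶠ Λ in (U : Filter (PointPattern d)),
      ∀ q ∈ Λ.carrier, ‖q‖ ≤ ε⁻¹ → ∃ p ∈ L.carrier, dist q p ≤ ε := by
    by_contra hcon
    rw [← Ultrafilter.eventually_not] at hcon
    have hch : ∀ Λ : PointPattern d, ∃ q : EuclideanSpace ℝ (Fin d),
        (¬ ∀ q ∈ Λ.carrier, ‖q‖ ≤ ε⁻¹ → ∃ p ∈ L.carrier, dist q p ≤ ε) →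
        q ∈ Λ.carrier ∧ ‖q‖ ≤ ε⁻¹ ∧ ∀ p ∈ L.carrier, ε < dist q p := by
      intro Λ
      by_cases hΛ : ∀ q ∈ Λ.carrier, ‖q‖ ≤ ε⁻¹ → ∃ p ∈ L.carrier, dist q p ≤ ε
      · exact ⟨0, fun h => absurd hΛ h⟩
      · push Not at hΛ
        obtain ⟨q, hq⟩ := hΛ
        exact ⟨q, fun _ => hq⟩
    choose q hq using hch
    have hqU : ∀ᶠ Λ in (U : Filter (PointPattern d)),
        q Λ ∈ Λ.carrier ∧ ‖q Λ‖ ≤ ε⁻¹ ∧ ∀ p ∈ L.carrier, ε < dist (q Λ) p := hcon.mono hq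
    obtain ⟨p, -, hp⟩ := (isCompact_closedBall (0 : EuclideanSpace ℝ (Fin d)) ε⁻¹).ultrafilter_le_nhds'
      (U.map q) (hqU.mono fun Λ h => mem_closedBall_zero_iff.2 h.2.1)
    have hp' : Tendsto q U (𝓝 p) := hp
    have hpL : p ∈ L.carrier := by
      intro δ hδ
      filter_upwards [hqU, hp'.eventually (closedBall_mem_nhds p hδ)] with Λ h h'
      exact ⟨q Λ, h.1, by rw [dist_comm]; exact h'⟩
    obtain ⟨Λ, h, h'⟩ := (hqU.and (hp'.eventually (closedBall_mem_nhds p hε))).exists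
    exact (h.2.2 p hpL).not_ge h'
  filter_upwards [h1, h2] with Λ a b using ⟨a, b⟩

/-- This supplies the pseudometrizability required by the measure-theoretic argument. -/
instance : IsCountablyGenerated (𝓤 (PointPattern d)) := by
  have h : (𝓤 (PointPattern d)).HasBasis (fun _ : ℕ => True)
      (fun n => {p | Close (1 / ((n : ℝ) + 1)) p.1 p.2}) := by
    refine hasBasis_uniformity.to_hasBasis (fun ε hε => ?_)
      fun n _ => ⟨_, Nat.one_div_pos_of_nat, Subset.rfl⟩
    obtain ⟨n, hn⟩ := exists_nat_one_div_lt hε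
    exact ⟨n, trivial, fun p hp => Close.mono Nat.one_div_pos_of_nat hn.le hp⟩
  exact h.isCountablyGenerated

theorem continuous_vadd_left (Λ : PointPattern d) :
    Continuous fun t : EuclideanSpace ℝ (Fin d) => t +ᵥ Λ := by
  refine continuous_iff_continuousAt.2 fun t => (nhds_hasBasis_close (t +ᵥ Λ)).tendsto_right_iff.2
    fun ε hε => ?_
  filter_upwards [closedBall_mem_nhds t hε] with s hs
  have hst : ‖s - t‖ ≤ ε := by rw [← dist_eq_norm]; exact hs
  have := close_vadd_self hst (t +ᵥ Λ)
  rwa [vadd_vadd, sub_add_cancel] at this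

instance (Λ : PointPattern d) : CompactSpace Λ.hull :=
  isCompact_iff_compactSpace.1 (isClosed_closure (s := AddAction.orbit _ Λ)).isCompact

instance (Λ : PointPattern d) : ContinuousConstVAdd (EuclideanSpace ℝ (Fin d)) Λ.hull :=
  ⟨fun t => ((uniformContinuous_vadd t).continuous.comp continuous_subtype_val).subtype_mk _⟩

theorem self_mem_hull (Λ : PointPattern d) : Λ ∈ Λ.hull :=
  subset_closure (AddAction.mem_orbit_self Λ)

/-! ### Uniform discreteness and separation in the hull -/

theorem UniformlyDiscrete.exists_eq_of_dist_lt {S : Set (EuclideanSpace ℝ (Fin d))}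
    (h : UniformlyDiscrete S) : ∃ r : ℝ, 0 < r ∧ ∀ x ∈ S, ∀ y ∈ S, dist x y < r → x = y := by
  obtain ⟨r, hr, hS⟩ := h
  refine ⟨r, hr, fun x hx y hy hxy => by_contra fun hne => ?_⟩
  have h1 : (r : ENNReal) < edist x y := hS hx hy hne
  rw [edist_nndist, ENNReal.coe_lt_coe] at h1
  exact absurd hxy (not_lt.2 (NNReal.coe_lt_coe.2 h1).le)

theorem IsDelone.uniformlyDiscrete {Λ : PointPattern d} (h : Λ.IsDelone) :
    UniformlyDiscrete Λ.carrier := by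
  obtain ⟨D, hD⟩ := h
  exact ⟨D.packingRadius, D.packingRadius_pos, hD ▸ D.isSeparated_packingRadius⟩

/-- Uniform discreteness passes to the hull, with the same radius. -/
theorem eq_of_dist_lt_of_mem_hull {Λ : PointPattern d} {r : ℝ}
    (hr : ∀ x ∈ Λ.carrier, ∀ y ∈ Λ.carrier, dist x y < r → x = y) {P : PointPattern d}
    (hP : P ∈ Λ.hull) {p q : EuclideanSpace ℝ (Fin d)} (hp : p ∈ P.carrier) (hq : q ∈ P.carrier)
    (hpq : dist p q < r) : p = q := by
  by_contra hne
  have hpos := dist_pos.2 hne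
  -- Moving both points by `ε` keeps their distance below `r` and keeps them distinct; the last term
  -- puts both in the ball of radius `ε⁻¹`.
  let ε : ℝ := min (min ((r - dist p q) / 3) (dist p q / 3)) (‖p‖ + ‖q‖ + 1)⁻¹
  have hs : 0 < ‖p‖ + ‖q‖ + 1 := by positivity
  have hε : 0 < ε := lt_min (lt_min (by linarith) (by linarith)) (inv_pos.2 hs)
  have h1 : ε ≤ (r - dist p q) / 3 := (min_le_left _ _).trans (min_le_left _ _)
  have h2 : ε ≤ dist p q / 3 := (min_le_left _ _).trans (min_le_right _ _)
  have h3 : ‖p‖ + ‖q‖ + 1 ≤ ε⁻¹ := (le_inv_comm₀ hs hε).2 (min_le_right _ _)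
  obtain ⟨_, ⟨t, rfl⟩, hc⟩ := mem_closure_iff_close.1 hP ε hε
  obtain ⟨x, hx, hpx⟩ := hc.1 p hp (by linarith [norm_nonneg q])
  obtain ⟨y, hy, hqy⟩ := hc.1 q hq (by linarith [norm_nonneg p])
  have hxy : x - t = y - t := by
    refine hr _ (mem_vadd_iff.1 hx) _ (mem_vadd_iff.1 hy) ?_
    rw [dist_sub_right]
    have := dist_triangle4 x p q y
    rw [dist_comm x p] at this
    linarith
  have hxy' : x = y := sub_left_injective hxy
  subst hxy'
  have := dist_triangle p x q
  rw [dist_comm x q] at this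
  linarith

/-- In the hull of a uniformly discrete pattern, indistinguishable patterns are equal. -/
theorem t2Space_hull {Λ : PointPattern d} (h : UniformlyDiscrete Λ.carrier) : T2Space Λ.hull := by
  obtain ⟨r, hr0, hr⟩ := h.exists_eq_of_dist_lt
  have key : ∀ P Q : PointPattern d, Q ∈ Λ.hull → (∀ ε : ℝ, 0 < ε → Close ε P Q) →
      P.carrier ⊆ Q.carrier := by
    intro P Q hQ hPQ p hp
    have hnear : ∀ δ : ℝ, 0 < δ → ∃ q ∈ Q.carrier, dist p q ≤ δ := by
      intro δ hδ
      have hs : 0 < ‖p‖ + 1 := by positivity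
      obtain ⟨q, hq, hpq⟩ := (hPQ (min δ (‖p‖ + 1)⁻¹) (lt_min hδ (inv_pos.2 hs))).1 p hp
        (((le_inv_comm₀ hs (lt_min hδ (inv_pos.2 hs))).2 (min_le_right _ _)).trans' (by simp))
      exact ⟨q, hq, hpq.trans (min_le_left _ _)⟩
    obtain ⟨q, hq, hpq⟩ := hnear (r / 3) (by linarith)
    have : p = q := by
      refine eq_of_forall_dist_le fun δ hδ => ?_
      obtain ⟨q', hq', hpq'⟩ := hnear (min δ (r / 3)) (lt_min hδ (by linarith))
      have hqq' : q = q' := by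
        refine eq_of_dist_lt_of_mem_hull hr hQ hq hq' ?_
        have := dist_triangle q p q'
        rw [dist_comm q p] at this
        have := hpq'.trans (min_le_right _ _)
        linarith
      subst hqq'
      exact hpq'.trans (min_le_left _ _)
    exact this ▸ hq
  -- Uniform spaces are regular, so T0 is enough.
  have : T0Space Λ.hull := by
    refine (t0Space_iff_inseparable _).2 fun P Q hPQ => Subtype.ext ?_
    have hins : Inseparable P.1 Q.1 := hPQ.map continuous_subtype_val
    have hclose : ∀ ε : ℝ, 0 < ε → Close ε P.1 Q.1 := fun ε hε =>
      hasBasis_uniformity.inseparable_iff_uniformity.1 hins ε hε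
    exact PointPattern.ext ((key _ _ Q.2 hclose).antisymm
      (key _ _ P.2 fun ε hε => (hclose ε hε).symm))
  infer_instance

/-! ### Repetitivity and minimality -/

/-- Every pattern in the hull of a repetitive pattern contains it in its orbit closure. -/
theorem IsRepetitive.exists_close_vadd {Λ : PointPattern d} (h : Λ.IsRepetitive)
    {P : PointPattern d} (hP : P ∈ Λ.hull) {ε : ℝ} (hε : 0 < ε) :
    ∃ t : EuclideanSpace ℝ (Fin d), Close ε Λ (t +ᵥ P) := by
  -- The extra `ε` keeps in the patch a point of `Λ` that is `ε`-close to a point of norm at most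
  -- `ε⁻¹`.
  obtain ⟨R, hR, hrep⟩ := h (closedBall 0 (ε⁻¹ + ε)) (isCompact_closedBall _ _)
  have hδ : 0 < min ε R⁻¹ := lt_min hε (inv_pos.2 hR)
  have hRδ : R ≤ (min ε R⁻¹)⁻¹ := (le_inv_comm₀ hR hδ).2 (min_le_right _ _)
  obtain ⟨_, ⟨s, rfl⟩, hc⟩ := mem_closure_iff_close.1 hP _ hδ
  -- Centring at `-s` places the copy of the patch within radius `R` of the origin in `s +ᵥ Λ`,
  -- where `P` is close to it.
  obtain ⟨t, htB, hΛ⟩ := hrep (-s)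
  have hball : ∀ x : EuclideanSpace ℝ (Fin d), ‖x‖ ≤ ε⁻¹ + ε → ‖x + (s + t)‖ ≤ R := by
    intro x hx
    have : t + x ∈ closedBall (-s) R :=
      htB (vadd_mem_vadd_set (mem_closedBall_zero_iff.2 hx) : t +ᵥ x ∈ _)
    rw [mem_closedBall, dist_eq_norm] at this
    rwa [show x + (s + t) = t + x - -s by abel]
  refine ⟨-(s + t), fun x hx hxn => ?_, fun y hy hyn => ?_⟩
  · have hxn' : ‖x‖ ≤ ε⁻¹ + ε := by linarith
    have hmem : t +ᵥ x ∈ Λ.carrier := by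
      refine (hΛ.ge ?_).1
      exact vadd_mem_vadd_set ⟨hx, mem_closedBall_zero_iff.2 hxn'⟩
    obtain ⟨p, hp, hpx⟩ := hc.2 (x + (s + t)) (mem_vadd_iff.2 (by
      convert hmem using 1; rw [vadd_eq_add]; abel)) ((hball x hxn').trans hRδ)
    refine ⟨p - (s + t), mem_vadd_iff.2 (by rwa [sub_neg_eq_add, sub_add_cancel]), ?_⟩
    refine le_trans (le_of_eq ?_) (hpx.trans (min_le_left _ _))
    rw [dist_eq_norm, dist_eq_norm]; congr 1; abel
  · have hyP : y + (s + t) ∈ P.carrier := by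
      simpa only [sub_neg_eq_add] using mem_vadd_iff.1 hy
    obtain ⟨m, hm, hmy⟩ := hc.1 _ hyP ((hball y (by linarith)).trans hRδ)
    have hmy' : dist y (m - (s + t)) ≤ ε := by
      refine le_trans (le_of_eq ?_) (hmy.trans (min_le_left _ _))
      rw [dist_eq_norm, dist_eq_norm]; congr 1; abel
    refine ⟨m - (s + t), ?_, hmy'⟩
    have hmn : ‖m - (s + t)‖ ≤ ε⁻¹ + ε := by
      have h1 : ‖m - (s + t)‖ ≤ ‖y‖ + ‖m - (s + t) - y‖ := norm_le_norm_add_norm_sub' _ _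
      rw [dist_comm, dist_eq_norm] at hmy'
      linarith
    have hmem : t +ᵥ (m - (s + t)) ∈ t +ᵥ (Λ.carrier ∩ closedBall 0 (ε⁻¹ + ε)) := by
      rw [← hΛ]
      refine ⟨?_, vadd_mem_vadd_set (mem_closedBall_zero_iff.2 hmn)⟩
      convert mem_vadd_iff.1 hm using 1
      rw [vadd_eq_add]; abel
    exact ((vadd_mem_vadd_set_iff).1 hmem).1

theorem dense_orbit_self_hull (Λ : PointPattern d) :
    Dense (AddAction.orbit (EuclideanSpace ℝ (Fin d)) (⟨Λ, Λ.self_mem_hull⟩ : Λ.hull)) := by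
  intro P
  rw [closure_subtype]
  refine closure_mono ?_ P.2
  rintro _ ⟨t, rfl⟩
  exact ⟨_, ⟨t, rfl⟩, rfl⟩

theorem IsRepetitive.isMinimal_hull {Λ : PointPattern d} (h : Λ.IsRepetitive) :
    AddAction.IsMinimal (EuclideanSpace ℝ (Fin d)) Λ.hull := by
  refine ⟨fun P => ?_⟩
  have h0 : (⟨Λ, Λ.self_mem_hull⟩ : Λ.hull) ∈
      closure (AddAction.orbit (EuclideanSpace ℝ (Fin d)) P) := by
    rw [closure_subtype, mem_closure_iff_close]
    intro ε hε
    obtain ⟨t, ht⟩ := h.exists_close_vadd P.2 hε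
    exact ⟨_, ⟨_, ⟨t, rfl⟩, rfl⟩, ht⟩
  have h1 : AddAction.orbit (EuclideanSpace ℝ (Fin d)) (⟨Λ, Λ.self_mem_hull⟩ : Λ.hull) ⊆
      closure (AddAction.orbit (EuclideanSpace ℝ (Fin d)) P) := by
    rintro _ ⟨t, rfl⟩
    refine map_mem_closure (continuous_const_vadd t) h0 ?_
    rintro _ ⟨s, rfl⟩
    exact ⟨t + s, add_vadd t s P⟩
  exact Dense.of_closure (Λ.dense_orbit_self_hull.mono h1)

end PointPattern

namespace PointPattern

variable {d : ℕ}

/-! ### Deformations -/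

theorem AgreeTo.close {ε : ℝ} (hε : 0 < ε) {P Q : PointPattern d} (h : AgreeTo ε⁻¹ P Q) :
    Close ε P Q := by
  refine ⟨fun x hx hxn => ⟨x, ?_, by simpa using hε.le⟩, fun x hx hxn => ⟨x, ?_, by simpa using hε.le⟩⟩
  · have : x ∈ Q.carrier ∩ closedBall 0 ε⁻¹ := h ▸ ⟨hx, mem_closedBall_zero_iff.2 hxn⟩
    exact this.1
  · have : x ∈ P.carrier ∩ closedBall 0 ε⁻¹ := h.symm ▸ ⟨hx, mem_closedBall_zero_iff.2 hxn⟩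
    exact this.1

theorem neg_vadd_mem_transversal {Λ : PointPattern d} {x : EuclideanSpace ℝ (Fin d)}
    (hx : x ∈ Λ.carrier) : -x +ᵥ Λ ∈ Λ.transversal :=
  subset_closure ⟨x, hx, rfl⟩

theorem exists_norm_le_of_mem_transversal {Λ P : PointPattern d} (hP : P ∈ Λ.transversal) {ε : ℝ}
    (hε : 0 < ε) : ∃ p ∈ P.carrier, ‖p‖ ≤ ε := by
  obtain ⟨_, ⟨x, hx, rfl⟩, hc⟩ := mem_closure_iff_close.1 hP ε hε
  obtain ⟨p, hp, hxp⟩ := hc.2 0 (mem_vadd_iff.2 (by simpa using hx)) (by simpa using hε.le)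
  exact ⟨p, hp, by simpa using hxp⟩

/-- A translate of `Λ` close to an element of the transversal is, up to a small shift, a translate
of `Λ` by one of its own points. -/
theorem exists_recenter {Λ P : PointPattern d} (hP : P ∈ Λ.transversal) {δ : ℝ} (hδ : 0 < δ)
    {a : EuclideanSpace ℝ (Fin d)} (h : Close (min (min δ 1 / 4) (1 / 2)) P (a +ᵥ Λ)) :
    ∃ x ∈ Λ.carrier, ‖a + x‖ ≤ min δ 1 / 2 ∧ Close δ P (-x +ᵥ Λ) := by
  set η := min (min δ 1 / 4) (1 / 2) with hη
  have h1 : 0 < min δ 1 := lt_min hδ one_pos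
  have hη0 : 0 < η := lt_min (by linarith) (by norm_num)
  have hη1 : η ≤ min δ 1 / 4 := min_le_left _ _
  have hη2 : η ≤ η⁻¹ := by
    have h2 : η ≤ 1 := (min_le_right _ _).trans (by norm_num)
    exact h2.trans ((one_le_inv₀ hη0).2 h2)
  -- A point near the origin in `P` has a partner `q` with norm at most `2 * η ≤ min δ 1 / 2`, the
  -- error allowed by `Close.trans_half`.
  obtain ⟨p, hp, hpn⟩ := exists_norm_le_of_mem_transversal hP hη0
  obtain ⟨q, hq, hpq⟩ := h.1 p hp (hpn.trans hη2)
  have hqn : ‖q‖ ≤ min δ 1 / 2 := by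
    have := norm_le_norm_add_norm_sub' q p
    rw [dist_comm, dist_eq_norm] at hpq
    linarith
  refine ⟨q - a, mem_vadd_iff.1 hq, by simpa using hqn, ?_⟩
  have h2 : Close (min δ 1 / 2) (a +ᵥ Λ) (-q +ᵥ (a +ᵥ Λ)) :=
    close_vadd_self (by simpa using hqn) _
  have h3 := Close.trans_half hδ (h.mono hη0 (by linarith)) h2
  rwa [vadd_vadd, show -q + a = -(q - a) by abel] at h3

/-- Points of the transversal of a repetitive Meyer set with the same image in the maximal
equicontinuous factor are approximated by `Λ - x₁` and `Λ - x₂` such that, for some return vector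
`v`, the patterns `Λ - (x₁ + v)` and `Λ - (x₂ + v)` are both close to the first of them. -/
theorem exists_common_return_vector {Λ : PointPattern d} (hMeyer : Λ.IsMeyer)
    (hrep : Λ.IsRepetitive) {Λ₁ Λ₂ : Λ.hull} (h₁ : Λ₁.1 ∈ Λ.transversal) (h₂ : Λ₂.1 ∈ Λ.transversal)
    (hR : RMax (EuclideanSpace ℝ (Fin d)) Λ₁ Λ₂) {ε : ℝ} (hε : 0 < ε) :
    ∃ x₁ ∈ Λ.carrier, ∃ y₁ ∈ Λ.carrier, ∃ x₂ ∈ Λ.carrier, ∃ y₂ ∈ Λ.carrier,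
      y₁ - x₁ = y₂ - x₂ ∧ Close ε Λ₁.1 (-x₁ +ᵥ Λ) ∧ Close ε Λ₁.1 (-y₁ +ᵥ Λ) ∧
        Close ε Λ₂.1 (-x₂ +ᵥ Λ) ∧ Close ε Λ₁.1 (-y₂ +ᵥ Λ) := by
  obtain ⟨r, hr0, hr⟩ := hMeyer.2.exists_eq_of_dist_lt
  have := t2Space_hull hMeyer.1.uniformlyDiscrete
  have := hrep.isMinimal_hull
  -- Each of the four recentrings below shifts by at most `r / 6`, in total less than the separation
  -- `r` of `Λ - Λ`.
  let δ := min ε (r / 3)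
  have hδ : 0 < δ := lt_min hε (by linarith)
  let η := min (min δ 1 / 4) (1 / 2)
  have hη : 0 < η := lt_min (by have := lt_min hδ one_pos; linarith) (by norm_num)
  let V : Λ.hull → Set Λ.hull := fun P => Subtype.val ⁻¹' interior {Q | Close η P.1 Q}
  have hV : ∀ P, IsOpen (V P) := fun P => isOpen_interior.preimage continuous_subtype_val
  have hPV : ∀ P, P ∈ V P := fun P =>
    mem_interior_iff_mem_nhds.2 ((nhds_hasBasis_close P.1).mem_of_mem hη)
  have hVc : ∀ {P Q : Λ.hull}, Q ∈ V P → Close η P.1 Q.1 := fun {P Q} h =>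
    (interior_subset h : Q.1 ∈ {Q' | Close η P.1 Q'})
  obtain ⟨z, hz, z', hz', t, htz, htz'⟩ := hR.regionallyProximal
    (fun P => (continuous_vadd_left P.1).subtype_mk _) (hV Λ₁) (hPV Λ₁) (hV Λ₂) (hPV Λ₂)
  -- Both conditions on `z` are open, so the dense orbit of `Λ` meets them with the same `t`.
  have happrox : ∀ {P z : Λ.hull}, z ∈ V P → t +ᵥ z ∈ V Λ₁ →
      ∃ a : EuclideanSpace ℝ (Fin d), Close η P.1 (a +ᵥ Λ) ∧ Close η Λ₁.1 ((t + a) +ᵥ Λ) := by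
    intro P z hz htz
    have hopen : IsOpen (V P ∩ (t +ᵥ ·) ⁻¹' V Λ₁) :=
      (hV P).inter ((hV Λ₁).preimage (continuous_const_vadd t))
    obtain ⟨_, ⟨ha, hta⟩, a, rfl⟩ :=
      Λ.dense_orbit_self_hull.inter_open_nonempty _ hopen ⟨z, hz, htz⟩
    refine ⟨a, hVc ha, ?_⟩
    rw [add_vadd]
    exact hVc hta
  obtain ⟨a₂, ha₂, hb₂⟩ := happrox hz htz
  obtain ⟨a₁, ha₁, hb₁⟩ := happrox hz' htz'
  obtain ⟨x₁, hx₁, hax₁, hcx₁⟩ := exists_recenter h₁ hδ ha₁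
  obtain ⟨y₁, hy₁, hay₁, hcy₁⟩ := exists_recenter h₁ hδ hb₁
  obtain ⟨x₂, hx₂, hax₂, hcx₂⟩ := exists_recenter h₂ hδ ha₂
  obtain ⟨y₂, hy₂, hay₂, hcy₂⟩ := exists_recenter h₁ hδ hb₂
  have hδε : δ ≤ ε := min_le_left _ _
  have hm : min δ 1 ≤ r / 3 := (min_le_left _ _).trans (min_le_right _ _)
  refine ⟨x₁, hx₁, y₁, hy₁, x₂, hx₂, y₂, hy₂, ?_, hcx₁.mono hδ hδε, hcy₁.mono hδ hδε,
    hcx₂.mono hδ hδε, hcy₂.mono hδ hδε⟩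
  -- Both return vectors approximate `-t`, and the Meyer property makes them equal.
  refine hr _ (sub_mem_sub hy₁ hx₁) _ (sub_mem_sub hy₂ hx₂) ?_
  have e : y₁ - x₁ - (y₂ - x₂) =
      ((t + a₁ + y₁) - (a₁ + x₁)) - ((t + a₂ + y₂) - (a₂ + x₂)) := by abel
  rw [dist_eq_norm, e]
  have n1 := norm_sub_le ((t + a₁ + y₁) - (a₁ + x₁)) ((t + a₂ + y₂) - (a₂ + x₂))
  have n2 := norm_sub_le (t + a₁ + y₁) (a₁ + x₁)
  have n3 := norm_sub_le (t + a₂ + y₂) (a₂ + x₂)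
  linarith

/-- A generator with uniformly discrete differences of the deformed set is nonslip. -/
theorem isNonslip_of_uniformlyDiscrete_deform {Λ : PointPattern d} (hMeyer : Λ.IsMeyer)
    (hrep : Λ.IsRepetitive) {F : Λ.carrier → EuclideanSpace ℝ (Fin d)} (hF : Λ.IsWeaklyPE F)
    (hD : UniformlyDiscrete ((Λ.deform F).carrier - (Λ.deform F).carrier)) : Λ.IsNonslip F := by
  obtain ⟨Ft, hFt⟩ := hF
  obtain ⟨r, hr0, hr⟩ := hD.exists_eq_of_dist_lt
  have huc : UniformContinuousOn Ft Λ.transversal :=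
    isClosed_closure.isCompact.uniformContinuousOn_of_continuous hFt.1
  have hmod : ∀ κ : ℝ, 0 < κ → ∃ δ : ℝ, 0 < δ ∧ ∀ P ∈ Λ.transversal, ∀ Q ∈ Λ.transversal,
      Close δ P Q → dist (Ft P) (Ft Q) < κ := by
    intro κ hκ
    obtain ⟨δ, hδ, h⟩ :=
      (hasBasis_uniformity.uniformContinuousOn_iff uniformity_basis_dist).1 huc κ hκ
    exact ⟨δ, hδ, fun P hP Q hQ => h P hP Q hQ⟩
  -- The slip contributes less than `r / 4` and the four approximations below at most `4 * (r / 8)`,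
  -- so the deformed vectors differ by less than `r`. The bound `κ / 4` serves the final estimate,
  -- which also has four errors.
  obtain ⟨ε, hε, hεF⟩ := hmod (r / 4) (by linarith)
  refine ⟨Ft, hFt, ε, hε, fun Λ₁ Λ₂ h₁ h₂ hR hagree => ?_⟩
  have h12 := hεF _ h₁ _ h₂ (hagree.close hε)
  refine eq_of_forall_dist_le fun κ hκ => ?_
  have hκ0 : 0 < min (κ / 4) (r / 8) := lt_min (by linarith) (by linarith)
  obtain ⟨δ, hδ, hδF⟩ := hmod _ hκ0
  obtain ⟨x₁, hx₁, y₁, hy₁, x₂, hx₂, y₂, hy₂, hv, hcx₁, hcy₁, hcx₂, hcy₂⟩ :=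
    exists_common_return_vector hMeyer hrep h₁ h₂ hR hδ
  have happrox : ∀ {P : PointPattern d}, P ∈ Λ.transversal → ∀ {x} (hx : x ∈ Λ.carrier),
      Close δ P (-x +ᵥ Λ) → dist (Ft P) (F ⟨x, hx⟩) < min (κ / 4) (r / 8) := by
    intro P hP x hx hc
    rw [hFt.2 ⟨x, hx⟩]
    exact hδF _ hP _ (neg_vadd_mem_transversal hx) hc
  have d1 := happrox h₁ hx₁ hcx₁
  have d2 := happrox h₁ hy₁ hcy₁
  have d3 := happrox h₂ hx₂ hcx₂
  have d4 := happrox h₁ hy₂ hcy₂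
  have m1 := min_le_left (κ / 4) (r / 8)
  have m2 := min_le_right (κ / 4) (r / 8)
  have dy : dist (F ⟨y₁, hy₁⟩) (F ⟨y₂, hy₂⟩) < 2 * min (κ / 4) (r / 8) := by
    have := dist_triangle_left (F ⟨y₁, hy₁⟩) (F ⟨y₂, hy₂⟩) (Ft Λ₁.1)
    linarith
  have dx : dist (F ⟨x₁, hx₁⟩) (F ⟨x₂, hx₂⟩) ≤
      2 * min (κ / 4) (r / 8) + dist (Ft Λ₁.1) (Ft Λ₂.1) := by
    have := dist_triangle4 (F ⟨x₁, hx₁⟩) (Ft Λ₁.1) (Ft Λ₂.1) (F ⟨x₂, hx₂⟩)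
    rw [dist_comm (F ⟨x₁, hx₁⟩) (Ft Λ₁.1)] at this
    linarith
  have hmem : ∀ {x} (hx : x ∈ Λ.carrier), x + F ⟨x, hx⟩ ∈ (Λ.deform F).carrier :=
    fun {x} hx => ⟨⟨x, hx⟩, rfl⟩
  have hdiff : (y₁ + F ⟨y₁, hy₁⟩ - (x₁ + F ⟨x₁, hx₁⟩)) - (y₂ + F ⟨y₂, hy₂⟩ - (x₂ + F ⟨x₂, hx₂⟩)) =
      (F ⟨y₁, hy₁⟩ - F ⟨y₂, hy₂⟩) - (F ⟨x₁, hx₁⟩ - F ⟨x₂, hx₂⟩) := by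
    rw [← sub_eq_zero] at hv
    rw [← sub_eq_zero, ← hv]
    abel
  -- Equality of the deformed vectors replaces the coarse bound `dx` by the arbitrarily small bound
  -- `dy`.
  have heq := hr _ (sub_mem_sub (hmem hy₁) (hmem hx₁)) _ (sub_mem_sub (hmem hy₂) (hmem hx₂)) (by
    rw [dist_eq_norm, hdiff]
    have := norm_sub_le (F ⟨y₁, hy₁⟩ - F ⟨y₂, hy₂⟩) (F ⟨x₁, hx₁⟩ - F ⟨x₂, hx₂⟩)
    rw [← dist_eq_norm (F ⟨y₁, hy₁⟩), ← dist_eq_norm (F ⟨x₁, hx₁⟩)] at this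
    linarith)
  rw [← sub_eq_zero, hdiff, sub_eq_zero] at heq
  have dxy : dist (F ⟨x₁, hx₁⟩) (F ⟨x₂, hx₂⟩) = dist (F ⟨y₁, hy₁⟩) (F ⟨y₂, hy₂⟩) := by
    rw [dist_eq_norm, dist_eq_norm, heq]
  have := dist_triangle4 (Ft Λ₁.1) (F ⟨x₁, hx₁⟩) (F ⟨x₂, hx₂⟩) (Ft Λ₂.1)
  rw [dist_comm (F ⟨x₂, hx₂⟩) (Ft Λ₂.1)] at this
  linarith

end PointPattern

theorem theorem1p4 {d : ℕ} (Λ : PointPattern d) (hMeyer : Λ.IsMeyer) (hrep : Λ.IsRepetitive)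
    (F : Λ.carrier → EuclideanSpace ℝ (Fin d)) (hF : Λ.IsShapeSemiconjugacyGenerator F)
    (hns : ¬ Λ.IsNonslip F) :
    ¬ (Λ.deform F).IsMeyer := fun h =>
  hns (PointPattern.isNonslip_of_uniformlyDiscrete_deform hMeyer hrep hF.weaklyPE h.2)
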